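/- **Setting.** Let $\mathcal A$ be a finite alphabet and $w$ a word of length $|w|$ over $\mathcal A$. A *$w$-matching machine* $\Gamma=(Q,o,F,\alpha,\delta,\gamma)$ consists of a finite set of states $Q$, an initial state $o\in Q$, a set of pre-match states $F\subseteq Q$, and maps $\alpha:Q\to\mathbb N$ (next position to check; $\alpha(q)<|w|$ for $q\in F$), $\delta:Q\times\mathcal A\to Q$ and $\gamma:Q\times\mathcal A\to\mathbb N$ (shift); $Q$ contains a sink $\odot$ with $\delta(\odot,x)=\odot$ and $\gamma(\odot,x)=0$ for all $x\in\mathcal A$. On a text $t$ (a finite word over $\mathcal A$, indexed from $0$) the machine starts with state $q=o$ and position $p=0$. While $p\le |t|-|w|$, it reads $x=t_{p+\alpha(q)}$, reports an occurrence at $p$ if $q\in F$ and $x=w_{\alpha(q)}$, and replaces $(q,p)$ by $(\delta(q,x),p+\gamma(q,x))$. Accesses at positions $i\ge|t|$ return letters given by an arbitrary fixed function of $t$ and $i$. The machine is *valid* if for every text $t$ the set of positions that it reports is exactly the set of positions at which $w$ occurs in $t$. Let $a_\Gamma(t)$ be the number of text accesses (that is, of iterations) on $t$, and let $K=\max_{q\in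 Q}\alpha(q)$. A *hidden Markov model* $H=(S,\pi,T,E)$ consists of a finite set $S$, an initial distribution $\pi$ on $S$, a transition matrix $T$ on $S$, and a distribution $E(s,\cdot)$ on $\mathcal A$ for each $s\in S$. For every $n$ it defines a distribution on $\mathcal A^n$, $$P_H(t)=\sum_{z\in S^n}\pi(z_0)E(z_0,t_0)\prod_{i=1}^{n-1}T(z_{i-1},z_i)E(z_i,t_i).$$ **Associated chain.** Let $X=S\times\mathcal A$, with the Markov model that has initial distribution $\tilde\pi(s,a)=\pi(s)E(s,a)$ and transitions $\tilde T((s,a),(s',a'))=T(s,s')E(s',a')$. The associated Markov chain has the finite state set $X^{K+1}\times Q$. It starts in $(d,q)$ with probability $\tilde\pi(d_0)\prod_{j=1}^{K}\tilde T(d_{j-1},d_j)$ if $q=o$, and $0$ otherwise. At the state $c=(d,q)$ let $x$ be the letter component of $d_{\alpha(q)}$ and let $\varphi(c)=\gamma(q,x)$. The probability of moving from $c$ to $(d',q')$ is $0$ if $q'\ne\delta(q,x)$; otherwise it is the probability, under the Markov model $(\tilde\pi,\tilde T)$, that the window of $K+1$ letters located $\varphi(c)$ positions after a window equal to $d$ equals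 $d'$, namely $$\sum_{e\in X^{\ell}}\ \mathbf 1\big[\text{the last }K+1\text{ letters of }de\text{ form }d'\big]\;\tilde T(d_K,e_0)\prod_{i=1}^{\ell-1}\tilde T(e_{i-1},e_i),\qquad \ell=\varphi(c),$$ which is $\mathbf 1[d=d']$ if $\ell=0$. **Theorem.** Let $\Gamma$ be a valid $w$-matching machine and $H$ a hidden Markov model. Then $0<a_\Gamma(t)<\infty$ for all texts $t$ with $|t|\ge|w|$. Writing $P(v)$ for the probability that the associated chain starts with the word of states $v$, and $|v|_c$ for the number of occurrences of $c$ in $v$, the limit frequency $$f_c=\lim_{k\to\infty}\ \sum_{v\in (X^{K+1}\times Q)^k}\frac{|v|_c}{k}\,P(v)$$ exists for every state $c\in X^{K+1}\times Q$. The sum $\sum_{t\in\mathcal A^n}\frac{|t|}{a_\Gamma(t)}P_H(t)$ converges as $n\to\infty$, so the asymptotic speed exists, and $$\lim_{n\to\infty}\sum_{t\in\mathcal A^n}\frac{|t|}{a_\Gamma(t)}\,P_H(t)=\sum_{c\in X^{K+1}\times Q}\varphi(c)\,f_c .$$ -/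

import Mathlib

open Filter Topology

/-! ### Pattern, texts and matching machines

A word of length `n` over the alphabet `A` is a function `Fin n → A`. -/

/-- A `w`-matching machine with set of states `Q`. -/
structure MatchingMachine {A : Type*} {m : ℕ} (w : Fin m → A) (Q : Type*) where
  /-- the initial state -/
  init : Q
  /-- the pre-match states -/
  preMatch : Set Q
  /-- the next-position-to-check function -/
  next : Q → ℕ
  /-- the transition function -/
  trans : Q → A → Q
  /-- the shift function -/
  shift : Q → A → ℕ
  /-- the sink state -/
  sink : Q
  next_lt : ∀ q ∈ preMatch, next q < m
  trans_sink : ∀ x, trans sink x = sink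
  shift_sink : ∀ x, shift sink x = 0

/-- A convention for accesses past the end of a text: `pad n t i` is the letter which is read when
position `i ≥ n` of a text `t` of length `n` is accessed. -/
abbrev EndConvention (A : Type*) := (n : ℕ) → (Fin n → A) → ℕ → A

/-- The letter obtained when position `i` of the text `t` is accessed. -/
def letterAt {A : Type*} (pad : EndConvention A) {n : ℕ} (t : Fin n → A) (i : ℕ) : A :=
  if h : i < n then t ⟨i, h⟩ else pad n t i

/-- `w` occurs at position `p` of `t`. -/
def OccursAt {A : Type*} {m n : ℕ} (w : Fin m → A) (t : Fin n → A) (p : ℕ) : Prop :=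
  ∃ h : p + m ≤ n, ∀ j : Fin m, t ⟨p + j, by omega⟩ = w j

namespace MatchingMachine

variable {A Q : Type*} {m : ℕ} {w : Fin m → A}

/-- The pair (current state, current position) at the beginning of iteration `i` of the generic
algorithm, where the loop condition is ignored (it is accounted for in `iterations`). -/
def config (M : MatchingMachine w Q) (pad : EndConvention A) {n : ℕ} (t : Fin n → A) :
    ℕ → Q × ℕ
  | 0 => (M.init, 0)
  | i + 1 =>
    let c := M.config pad t i
    let x := letterAt pad t (c.2 + M.next c.1)
    (M.trans c.1 x, c.2 + M.shift c.1 x)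

/-- The iterations that the generic algorithm performs on the text `t`: those at the beginning of
which the current position `p` satisfies the loop condition `p ≤ |t| - |w|`. As `p` never
decreases, they form an initial segment of `ℕ`. -/
def iterations (M : MatchingMachine w Q) (pad : EndConvention A) {n : ℕ} (t : Fin n → A) : Set ℕ :=
  {i | (M.config pad t i).2 + m ≤ n}

/-- The number of text accesses, i.e. of iterations, on the text `t`. -/
noncomputable def accesses (M : MatchingMachine w Q) (pad : EndConvention A) {n : ℕ}
    (t : Fin n → A) : ℕ :=
  (M.iterations pad t).ncard

/-- Iteration `i` on the text `t` prints `occurrence at position p`. -/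
def Reports (M : MatchingMachine w Q) (pad : EndConvention A) {n : ℕ} (t : Fin n → A)
    (i p : ℕ) : Prop :=
  i ∈ M.iterations pad t ∧ (M.config pad t i).2 = p ∧
    ∃ h : (M.config pad t i).1 ∈ M.preMatch,
      letterAt pad t (p + M.next (M.config pad t i).1) =
        w ⟨M.next (M.config pad t i).1, M.next_lt _ h⟩

/-- The machine is valid: on every text it reports all and only the occurrence positions of `w`. -/
def IsValid (M : MatchingMachine w Q) (pad : EndConvention A) : Prop :=
  ∀ (n : ℕ) (t : Fin n → A) (p : ℕ), (∃ i, M.Reports pad t i p) ↔ OccursAt w t p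

/-- The order of the machine, its greatest next-position-to-check. -/
def order [Fintype Q] (M : MatchingMachine w Q) : ℕ := Finset.univ.sup M.next

theorem next_lt_order_succ [Fintype Q] (M : MatchingMachine w Q) (q : Q) :
    M.next q < M.order + 1 :=
  Nat.lt_succ_of_le (Finset.le_sup (Finset.mem_univ q))

end MatchingMachine

/-! ### Markov models and hidden Markov models -/

/-- A (homogeneous, order 1) Markov model on a finite set `X`. -/
structure MarkovModel (X : Type*) [Fintype X] where
  init : X → ℝ
  trans : X → X → ℝ
  init_nonneg : ∀ x, 0 ≤ init x
  init_sum : ∑ x, init x = 1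
  trans_nonneg : ∀ x y, 0 ≤ trans x y
  trans_sum : ∀ x, ∑ y, trans x y = 1

/-- A hidden Markov model with set of hidden states `S`, emitting letters of `A`. -/
structure HMM (S A : Type*) [Fintype S] [Fintype A] extends MarkovModel S where
  emit : S → A → ℝ
  emit_nonneg : ∀ s a, 0 ≤ emit s a
  emit_sum : ∀ s, ∑ a, emit s a = 1

namespace MarkovModel

variable {X : Type*} [Fintype X]

/-- The probability that the chain, being in `x`, next visits `e 0, e 1, …, e (l - 1)`. -/
def pathProb (M : MarkovModel X) (x : X) {l : ℕ} (e : Fin l → X) : ℝ :=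
  ∏ i : Fin l, M.trans ((Fin.cons x e : Fin (l + 1) → X) i.castSucc) (e i)

/-- The probability of a word under a Markov model. -/
def wordProb (M : MarkovModel X) : {k : ℕ} → (Fin k → X) → ℝ
  | 0, _ => 1
  | _ + 1, v => M.init (v 0) * M.pathProb (v 0) (Fin.tail v)

open Classical in
/-- The expected frequency of the state `x` among the first `k` states of the chain,
`∑_{v ∈ X^k} (|v|_x / k) P(v)`. -/
noncomputable def meanFreq (M : MarkovModel X) (x : X) (k : ℕ) : ℝ :=
  ∑ v : Fin k → X,
    (((Finset.univ.filter fun i => v i = x).card : ℝ) / (k : ℝ)) * M.wordProb v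

open Classical in
/-- The probability of observing the window `d'` given that the window `d` occurs `l` positions
before: sum over the `l` states `e` following `d` such that `d'` is made of the last `K + 1` letters
of the concatenation of `d` and `e`. (For `l = 0` it is `1` if `d = d'` and `0` otherwise.) -/
noncomputable def windowProb (M : MarkovModel X) {K : ℕ} (d d' : Fin (K + 1) → X) (l : ℕ) : ℝ :=
  ∑ e : Fin l → X,
    if (fun j : Fin (K + 1) => Fin.append d e ⟨j + l, by omega⟩) = d' then
      M.pathProb (d (Fin.last K)) e
    else 0

theorem pathProb_nonneg (M : MarkovModel X) (x : X) {l : ℕ} (e : Fin l → X) :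
    0 ≤ M.pathProb x e :=
  Finset.prod_nonneg fun _ _ => M.trans_nonneg _ _

theorem pathProb_cons (M : MarkovModel X) (x y : X) {l : ℕ} (e : Fin l → X) :
    M.pathProb x (Fin.cons y e : Fin (l + 1) → X) = M.trans x y * M.pathProb y e := by
  unfold pathProb
  rw [Fin.prod_univ_succ]
  congr 1

theorem pathProb_sum (M : MarkovModel X) (l : ℕ) (x : X) :
    ∑ e : Fin l → X, M.pathProb x e = 1 := by
  induction l generalizing x with
  | zero => simp [pathProb]
  | succ l ih =>
    rw [← (Fin.consEquiv fun _ : Fin (l + 1) => X).sum_comp, Fintype.sum_prod_type]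
    simp only [Fin.consEquiv, Equiv.coe_fn_mk, pathProb_cons, ← Finset.mul_sum, ih, mul_one,
      M.trans_sum]

theorem wordProb_nonneg (M : MarkovModel X) {k : ℕ} (v : Fin k → X) : 0 ≤ M.wordProb v := by
  cases k with
  | zero => simp [wordProb]
  | succ k => exact mul_nonneg (M.init_nonneg _) (M.pathProb_nonneg _ _)

theorem wordProb_sum (M : MarkovModel X) (k : ℕ) : ∑ v : Fin k → X, M.wordProb v = 1 := by
  cases k with
  | zero => simp [wordProb]
  | succ k =>
    rw [← (Fin.consEquiv fun _ : Fin (k + 1) => X).sum_comp, Fintype.sum_prod_type]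
    simp only [Fin.consEquiv, Equiv.coe_fn_mk, wordProb, Fin.cons_zero, Fin.tail_cons,
      ← Finset.mul_sum, pathProb_sum, mul_one, M.init_sum]

theorem windowProb_nonneg (M : MarkovModel X) {K : ℕ} (d d' : Fin (K + 1) → X) (l : ℕ) :
    0 ≤ M.windowProb d d' l := by
  refine Finset.sum_nonneg fun e _ => ?_
  split_ifs
  exacts [M.pathProb_nonneg _ _, le_rfl]

theorem windowProb_sum (M : MarkovModel X) {K : ℕ} (d : Fin (K + 1) → X) (l : ℕ) :
    ∑ d' : Fin (K + 1) → X, M.windowProb d d' l = 1 := by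
  unfold windowProb
  rw [Finset.sum_comm]
  simp only [Finset.sum_ite_eq, Finset.mem_univ, if_true, pathProb_sum]

end MarkovModel

namespace HMM

variable {S A : Type*} [Fintype S] [Fintype A]

/-- The probability of the text `t` under the hidden Markov model `H`. -/
noncomputable def textProb (H : HMM S A) : {n : ℕ} → (Fin n → A) → ℝ
  | 0, _ => 1
  | n + 1, t => ∑ z : Fin (n + 1) → S, H.init (z 0) * H.emit (z 0) (t 0) *
      ∏ i : Fin n, H.trans (z i.castSucc) (z i.succ) * H.emit (z i.succ) (t i.succ)

/-- The Markov model on the pairs (hidden state, emitted letter). Together with the projection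
`Prod.snd` it is the hidden Markov model with deterministic emission, equivalent to `H`, obtained
by splitting the hidden states according to the letter emitted. -/
def split (H : HMM S A) : MarkovModel (S × A) where
  init x := H.init x.1 * H.emit x.1 x.2
  trans x y := H.trans x.1 y.1 * H.emit y.1 y.2
  init_nonneg x := mul_nonneg (H.init_nonneg _) (H.emit_nonneg _ _)
  init_sum := by
    simp only [Fintype.sum_prod_type, ← Finset.mul_sum, H.emit_sum, mul_one, H.init_sum]
  trans_nonneg x y := mul_nonneg (H.trans_nonneg _ _) (H.emit_nonneg _ _)
  trans_sum x := by
    simp only [Fintype.sum_prod_type, ← Finset.mul_sum, H.emit_sum, mul_one, H.trans_sum]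

end HMM

/-! ### The expected ratio and the associated Markov chain -/

namespace MatchingMachine

variable {A Q S : Type*} [Fintype A] [Fintype Q] [Fintype S] {m : ℕ} {w : Fin m → A}

/-- The expectation of the ratio of the text length to the number of text accesses, over the texts
of length `n` drawn from `H`. -/
noncomputable def expectedRatio (M : MatchingMachine w Q) (pad : EndConvention A) (H : HMM S A)
    (n : ℕ) : ℝ :=
  ∑ t : Fin n → A, ((n : ℝ) / (M.accesses pad t : ℝ)) * H.textProb t

/-- States of the associated chain: a window of `order + 1` pairs (hidden state, letter), which
starts at the current position, and a state of the machine. -/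
abbrev ChainState (M : MatchingMachine w Q) (S : Type*) : Type _ :=
  (Fin (M.order + 1) → S × A) × Q

/-- The letter read by the machine at a state of the associated chain. -/
def chainLetter (M : MatchingMachine w Q) (c : M.ChainState S) : A :=
  (c.1 ⟨M.next c.2, M.next_lt_order_succ c.2⟩).2

/-- The shift performed by the machine at a state of the associated chain. -/
def chainShift (M : MatchingMachine w Q) (c : M.ChainState S) : ℕ :=
  M.shift c.2 (M.chainLetter c)

open Classical in
/-- The Markov model of the pairs (window at the current position, current state of the machine)
parsed while reading an infinite text drawn from `H`. -/
noncomputable def chain (M : MatchingMachine w Q) (H : HMM S A) :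
    MarkovModel (M.ChainState S) where
  init c := if c.2 = M.init then H.split.wordProb c.1 else 0
  trans c c' :=
    if c'.2 = M.trans c.2 (M.chainLetter c) then H.split.windowProb c.1 c'.1 (M.chainShift c)
    else 0
  init_nonneg c := by
    split_ifs
    exacts [H.split.wordProb_nonneg _, le_rfl]
  init_sum := by
    simp only [Fintype.sum_prod_type, Finset.sum_ite_eq', Finset.mem_univ, if_true,
      H.split.wordProb_sum]
  trans_nonneg c c' := by
    split_ifs
    exacts [H.split.windowProb_nonneg _ _ _, le_rfl]
  trans_sum c := by
    simp only [Fintype.sum_prod_type, Finset.sum_ite_eq', Finset.mem_univ, if_true,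
      H.split.windowProb_sum]

end MatchingMachine

/-! Write `φ` for the shift function, `T` for the transition operator of the associated chain, `c_i`
for its state at iteration `i`. In finite dimension `φ = h + (g - T g)` with `T h = h`
(`exists_harmonic_add_coboundary`). Cesàro means annihilate the coboundary, so the limit frequencies
integrate `φ` to the initial mean of `h` (`exists_limitFreq`). It remains to show that the expected
ratio has the same limit.

Along a run, the position after `a` iterations is a sum of shifts, hence equals `∑ h(c_i)`, plus the
martingale `∑ (g(c_{i+1}) - T g(c_i))`, plus the bounded boundary term `g(c_0) - g(c_a)`. Validity
forces progress at a linear rate (`IsValid.run_pos_lt`) and shifts are bounded, so `a` is of order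
`n`. The martingale has second moment `O(n)` (`expect_sq_fluctuation_le`) and disappears after
division by `a`. The values `h(c_i)` form a bounded martingale, Cauchy in mean square
(`exists_expect_sq_harmonic_sub_le`). So the ratio is close in mean to `h(c_L)` for a large fixed
`L`, and `h(c_L)` has expectation the initial mean of `h`. No irreducibility is needed: `h` may
differ between recurrent classes, and only its mean matters.

Both arguments rest on the Markov property of the parsed sequence (`expect_mul_chainAt_succ`).
Expectations are finite sums over words long enough for all windows involved, so no measure on
infinite sequences appears. -/

namespace MarkovModel

variable {X : Type*} [Fintype X]

/-! ### The transition operator and the ergodic decomposition -/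

/-- The transition operator on functions of the state. -/
noncomputable def op (M : MarkovModel X) : (X → ℝ) →ₗ[ℝ] (X → ℝ) where
  toFun f x := ∑ y, M.trans x y * f y
  map_add' f g := by
    ext x
    simp [mul_add, Finset.sum_add_distrib]
  map_smul' a f := by
    ext x
    simp only [Pi.smul_apply, smul_eq_mul, RingHom.id_apply, Finset.mul_sum]
    exact Finset.sum_congr rfl fun _ _ => by ring

/-- The mean of a function of the state under the initial distribution. -/
noncomputable def initMean (M : MarkovModel X) : (X → ℝ) →ₗ[ℝ] ℝ where
  toFun f := ∑ x, M.init x * f x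
  map_add' f g := by simp [mul_add, Finset.sum_add_distrib]
  map_smul' a f := by
    simp only [Pi.smul_apply, smul_eq_mul, RingHom.id_apply, Finset.mul_sum]
    exact Finset.sum_congr rfl fun _ _ => by ring

theorem op_apply (M : MarkovModel X) (f : X → ℝ) (x : X) :
    M.op f x = ∑ y, M.trans x y * f y := rfl

theorem initMean_apply (M : MarkovModel X) (f : X → ℝ) :
    M.initMean f = ∑ x, M.init x * f x := rfl

theorem abs_op_le (M : MarkovModel X) {f : X → ℝ} {B : ℝ} (hf : ∀ x, |f x| ≤ B) (x : X) :
    |M.op f x| ≤ B := by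
  calc |M.op f x| ≤ ∑ y, |M.trans x y * f y| := Finset.abs_sum_le_sum_abs _ _
    _ ≤ ∑ y, M.trans x y * B := by
        refine Finset.sum_le_sum fun y _ => ?_
        rw [abs_mul, abs_of_nonneg (M.trans_nonneg x y)]
        exact mul_le_mul_of_nonneg_left (hf y) (M.trans_nonneg x y)
    _ = B := by rw [← Finset.sum_mul, M.trans_sum, one_mul]

theorem abs_initMean_le (M : MarkovModel X) {f : X → ℝ} {B : ℝ} (hf : ∀ x, |f x| ≤ B) :
    |M.initMean f| ≤ B := by
  calc |M.initMean f| ≤ ∑ y, |M.init y * f y| := Finset.abs_sum_le_sum_abs _ _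
    _ ≤ ∑ y, M.init y * B := by
        refine Finset.sum_le_sum fun y _ => ?_
        rw [abs_mul, abs_of_nonneg (M.init_nonneg y)]
        exact mul_le_mul_of_nonneg_left (hf y) (M.init_nonneg y)
    _ = B := by rw [← Finset.sum_mul, M.init_sum, one_mul]

theorem abs_op_pow_le (M : MarkovModel X) {f : X → ℝ} {B : ℝ} (hf : ∀ x, |f x| ≤ B) (k : ℕ)
    (x : X) : |(M.op ^ k) f x| ≤ B := by
  induction k generalizing x with
  | zero => simpa using hf x
  | succ k ih =>
    rw [pow_succ', Module.End.mul_apply]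
    exact M.abs_op_le ih x

theorem exists_abs_le (f : X → ℝ) : ∃ B, 0 ≤ B ∧ ∀ x, |f x| ≤ B :=
  ⟨∑ x, |f x|, Finset.sum_nonneg fun _ _ => abs_nonneg _, fun x =>
    Finset.single_le_sum (f := fun x => |f x|) (fun _ _ => abs_nonneg _) (Finset.mem_univ x)⟩

/-- If `y = z - T z` is harmonic, telescoping gives `k y = z - T^k z`. The right side stays bounded
because `T` contracts the sup norm, so `y = 0`. -/
theorem disjoint_ker_range_one_sub_op (M : MarkovModel X) :
    Disjoint (LinearMap.ker (1 - M.op)) (LinearMap.range (1 - M.op)) := by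
  rw [Submodule.disjoint_def]
  rintro y hy ⟨z, hz⟩
  have hy' : M.op y = y := by
    have : y - M.op y = 0 := by simpa using hy
    exact (sub_eq_zero.mp this).symm
  have hz' : y = z - M.op z := by simpa using hz.symm
  have key : ∀ k : ℕ, (k : ℝ) • y = z - (M.op ^ k) z := by
    intro k
    induction k with
    | zero => simp
    | succ k ih =>
      have h1 : M.op ((k : ℝ) • y) = (k : ℝ) • y := by rw [map_smul, hy']
      rw [ih, map_sub] at h1
      have h2 : (M.op ^ (k + 1)) z = M.op ((M.op ^ k) z) := by
        rw [pow_succ', Module.End.mul_apply]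
      push_cast
      rw [add_smul, one_smul, ih, h2]
      conv_lhs => rw [hz']
      rw [← h1]
      abel
  obtain ⟨B, -, hB⟩ := exists_abs_le z
  ext x
  by_contra hx
  have hpos : 0 < |y x| := abs_pos.mpr hx
  obtain ⟨k, hk⟩ := exists_nat_gt (2 * B / |y x|)
  rw [div_lt_iff₀ hpos] at hk
  have h1 := congrFun (key k) x
  simp only [Pi.smul_apply, smul_eq_mul, Pi.sub_apply] at h1
  have h2 : (k : ℝ) * |y x| = |z x - (M.op ^ k) z x| := by
    rw [← h1, abs_mul, Nat.abs_cast]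
  have h3 := abs_sub (z x) ((M.op ^ k) z x)
  have h4 := hB x
  have h5 := M.abs_op_pow_le hB k x
  linarith

/-- Every function is the sum of a harmonic function and a coboundary. -/
theorem exists_harmonic_add_coboundary (M : MarkovModel X) (f : X → ℝ) :
    ∃ h g : X → ℝ, M.op h = h ∧ f = h + (g - M.op g) := by
  have hc : IsCompl (LinearMap.ker (1 - M.op)) (LinearMap.range (1 - M.op)) := by
    -- By rank-nullity the dimensions already add up, so trivial intersection suffices.
    rw [Submodule.isCompl_iff_disjoint _ _ (by
      rw [add_comm, LinearMap.finrank_range_add_finrank_ker])]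
    exact M.disjoint_ker_range_one_sub_op
  have hf : f ∈ LinearMap.ker (1 - M.op) ⊔ LinearMap.range (1 - M.op) := by
    rw [hc.sup_eq_top]; trivial
  obtain ⟨h, hh, _, ⟨g, rfl⟩, hg⟩ := Submodule.mem_sup.mp hf
  refine ⟨h, g, ?_, by simpa using hg.symm⟩
  have : h - M.op h = 0 := by simpa using hh
  exact (sub_eq_zero.mp this).symm

theorem op_pow_of_harmonic (M : MarkovModel X) {h : X → ℝ} (hh : M.op h = h) (k : ℕ) :
    (M.op ^ k) h = h := by
  induction k with
  | zero => simp
  | succ k ih => rw [pow_succ', Module.End.mul_apply, ih, hh]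

/-- The Cesàro means of the expectations of `f` converge to the mean of its harmonic part. -/
theorem tendsto_cesaro_initMean (M : MarkovModel X) {f h g : X → ℝ} (hh : M.op h = h)
    (hf : f = h + (g - M.op g)) :
    Tendsto (fun k : ℕ => (∑ i ∈ Finset.range k, M.initMean ((M.op ^ i) f)) / (k : ℝ)) atTop
      (𝓝 (M.initMean h)) := by
  have hsum : ∀ k : ℕ, ∑ i ∈ Finset.range k, M.initMean ((M.op ^ i) f) =
      k * M.initMean h + (M.initMean g - M.initMean ((M.op ^ k) g)) := by
    intro k
    induction k with
    | zero => simp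
    | succ k ih =>
      have h1 : (M.op ^ (k + 1)) g = (M.op ^ k) (M.op g) := by
        rw [pow_succ, Module.End.mul_apply]
      rw [Finset.sum_range_succ, ih, hf, map_add, map_sub, M.op_pow_of_harmonic hh, map_add,
        map_sub, h1]
      push_cast
      ring
  obtain ⟨B, -, hB⟩ := exists_abs_le g
  have h0 : Tendsto (fun k : ℕ => (M.initMean g - M.initMean ((M.op ^ k) g)) / (k : ℝ)) atTop
      (𝓝 0) := by
    refine squeeze_zero_norm (fun k => ?_) (tendsto_const_div_atTop_nhds_zero_nat (2 * B))
    rw [norm_div, Real.norm_natCast, Real.norm_eq_abs]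
    gcongr
    have h3 := abs_sub (M.initMean g) (M.initMean ((M.op ^ k) g))
    have h4 := M.abs_initMean_le hB
    have h5 := M.abs_initMean_le (M.abs_op_pow_le hB k)
    linarith
  have h1 := h0.const_add (M.initMean h)
  rw [add_zero] at h1
  refine h1.congr' ?_
  filter_upwards [eventually_gt_atTop 0] with k hk
  have : (k : ℝ) ≠ 0 := by positivity
  rw [hsum]
  field_simp

/-! ### Frequencies -/

theorem sum_cons {k : ℕ} (F : (Fin (k + 1) → X) → ℝ) :
    ∑ v, F v = ∑ x, ∑ e : Fin k → X, F (Fin.cons x e : Fin (k + 1) → X) := by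
  rw [← (Fin.consEquiv fun _ : Fin (k + 1) => X).sum_comp, Fintype.sum_prod_type]
  rfl

/-- Each transition up to index `i` applies the operator once and the later ones sum to one. The
exponent is `i + 1` because `e 0` is already one transition away from `x`. -/
theorem sum_pathProb_mul (M : MarkovModel X) (f : X → ℝ) {k : ℕ} (i : Fin k) (x : X) :
    ∑ e : Fin k → X, M.pathProb x e * f (e i) = (M.op ^ (i.val + 1)) f x := by
  induction k generalizing x with
  | zero => exact i.elim0
  | succ k ih =>
    rw [sum_cons]
    simp only [pathProb_cons]
    cases i using Fin.cases with
    | zero =>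
      simp only [Fin.cons_zero, ← Finset.mul_sum, ← Finset.sum_mul, M.pathProb_sum]
      simp [op_apply]
    | succ i =>
      simp only [Fin.cons_succ, mul_assoc, ← Finset.mul_sum, ih]
      rw [Fin.val_succ, pow_succ' _ (i.val + 1), Module.End.mul_apply]
      rfl

theorem sum_wordProb_mul (M : MarkovModel X) (f : X → ℝ) {k : ℕ} (i : Fin k) :
    ∑ v : Fin k → X, M.wordProb v * f (v i) = M.initMean ((M.op ^ i.val) f) := by
  cases k with
  | zero => exact i.elim0
  | succ k =>
    rw [sum_cons]
    simp only [wordProb, Fin.cons_zero, Fin.tail_cons]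
    cases i using Fin.cases with
    | zero =>
      simp only [Fin.cons_zero, ← Finset.mul_sum, ← Finset.sum_mul, M.pathProb_sum]
      simp [initMean_apply]
    | succ i =>
      simp only [Fin.cons_succ, mul_assoc, ← Finset.mul_sum, sum_pathProb_mul]
      rfl

open Classical in
theorem meanFreq_eq (M : MarkovModel X) (x : X) (k : ℕ) :
    M.meanFreq x k =
      (∑ i ∈ Finset.range k, M.initMean ((M.op ^ i) (Pi.single x 1))) / (k : ℝ) := by
  unfold meanFreq
  rw [← Fin.sum_univ_eq_sum_range (fun i => M.initMean ((M.op ^ i) (Pi.single x 1)))]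
  simp only [← sum_wordProb_mul]
  rw [Finset.sum_comm, Finset.sum_div]
  refine Finset.sum_congr rfl fun v _ => ?_
  rw [← Finset.mul_sum, Finset.card_filter]
  push_cast
  simp only [Pi.single_apply]
  ring

/-- The limit frequencies exist and integrate every function to the mean of its harmonic part. -/
theorem exists_limitFreq (M : MarkovModel X) : ∃ α : X → ℝ,
    (∀ x, Tendsto (fun k : ℕ => M.meanFreq x k) atTop (𝓝 (α x))) ∧
    ∀ f h g : X → ℝ, M.op h = h → f = h + (g - M.op g) →
      ∑ x, f x * α x = M.initMean h := by
  classical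
  choose H G hH hG using fun x : X => M.exists_harmonic_add_coboundary (Pi.single x 1)
  refine ⟨fun x => M.initMean (H x), fun x => ?_, fun f h g hh hf => ?_⟩
  · simp only [meanFreq_eq]
    exact M.tendsto_cesaro_initMean (hH x) (hG x)
  · have hdec : f = ∑ x, f x • (Pi.single x (1 : ℝ) : X → ℝ) := by
      ext y
      simp [Finset.sum_apply, Pi.single_apply]
    -- Both sides are limits of the same Cesàro means of `f`, once directly and once by linearity
    -- over indicators, so the harmonic parts need not be compared.
    refine tendsto_nhds_unique ?_ (M.tendsto_cesaro_initMean hh hf)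
    have h1 := tendsto_finsetSum (Finset.univ : Finset X) fun x _ =>
      (M.tendsto_cesaro_initMean (hH x) (hG x)).const_mul (f x)
    refine h1.congr fun k => ?_
    conv_rhs => rw [hdec]
    simp only [map_sum, map_smul, smul_eq_mul]
    rw [Finset.sum_comm, Finset.sum_div]
    refine Finset.sum_congr rfl fun x _ => ?_
    rw [← Finset.mul_sum]
    ring

end MarkovModel

namespace MarkovModel

variable {X : Type*} [Fintype X]

/-! ### Expectations over random infinite sequences -/

/-- The word `u` followed by infinitely many copies of `a`. -/
def extend (a : X) {n : ℕ} (u : Fin n → X) (i : ℕ) : X :=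
  if h : i < n then u ⟨i, h⟩ else a

/-- The expectation of `F` over the random words of length `n`, continued by the letter `a`. -/
noncomputable def expect (M : MarkovModel X) (a : X) (n : ℕ) (F : (ℕ → X) → ℝ) : ℝ :=
  ∑ u : Fin n → X, M.wordProb u * F (extend a u)

section Linear

variable (M : MarkovModel X) (a : X) (n : ℕ)

theorem expect_add (F G : (ℕ → X) → ℝ) :
    M.expect a n (fun x => F x + G x) = M.expect a n F + M.expect a n G := by
  simp only [expect, mul_add, Finset.sum_add_distrib]

theorem expect_mul_left (b : ℝ) (F : (ℕ → X) → ℝ) :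
    M.expect a n (fun x => b * F x) = b * M.expect a n F := by
  simp only [expect, Finset.mul_sum]
  exact Finset.sum_congr rfl fun _ _ => by ring

theorem expect_sub (F G : (ℕ → X) → ℝ) :
    M.expect a n (fun x => F x - G x) = M.expect a n F - M.expect a n G := by
  simp only [expect, mul_sub, Finset.sum_sub_distrib]

theorem expect_sum {ι : Type*} (s : Finset ι) (F : ι → (ℕ → X) → ℝ) :
    M.expect a n (fun x => ∑ i ∈ s, F i x) = ∑ i ∈ s, M.expect a n (F i) := by
  simp only [expect, Finset.mul_sum]
  exact Finset.sum_comm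

theorem expect_const (b : ℝ) : M.expect a n (fun _ => b) = b := by
  simp only [expect, ← Finset.sum_mul, M.wordProb_sum, one_mul]

variable {M a n}

theorem expect_mono {F G : (ℕ → X) → ℝ} (h : ∀ x, F x ≤ G x) :
    M.expect a n F ≤ M.expect a n G :=
  Finset.sum_le_sum fun _ _ => mul_le_mul_of_nonneg_left (h _) (M.wordProb_nonneg _)

theorem abs_expect_le (F : (ℕ → X) → ℝ) :
    |M.expect a n F| ≤ M.expect a n fun x => |F x| := by
  refine (Finset.abs_sum_le_sum_abs _ _).trans (le_of_eq (Finset.sum_congr rfl fun u _ => ?_))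
  rw [abs_mul, abs_of_nonneg (M.wordProb_nonneg u)]

end Linear

theorem pathProb_seq (M : MarkovModel X) (x : ℕ → X) (l : ℕ) :
    M.pathProb (x 0) (fun j : Fin l => x (j + 1)) =
      ∏ i ∈ Finset.range l, M.trans (x i) (x (i + 1)) := by
  rw [← Fin.prod_univ_eq_prod_range (fun i => M.trans (x i) (x (i + 1)))]
  unfold pathProb
  refine Finset.prod_congr rfl fun i _ => ?_
  congr 1
  have : (Fin.cons (x 0) fun j : Fin l => x (j + 1) : Fin (l + 1) → X) = fun j : Fin (l + 1) => x j := by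
    ext j
    cases j using Fin.cases <;> simp
  rw [this]
  simp

theorem wordProb_seq (M : MarkovModel X) (x : ℕ → X) {n : ℕ} (hn : 0 < n) :
    M.wordProb (fun j : Fin n => x j) =
      M.init (x 0) * ∏ i ∈ Finset.range (n - 1), M.trans (x i) (x (i + 1)) := by
  cases n with
  | zero => omega
  | succ n => exact congrArg (M.init (x 0) * ·) (M.pathProb_seq x n)

/-- All three words are read off one infinite sequence, along which the probability is a product
over a range that splits at `r`. -/
theorem wordProb_append (M : MarkovModel X) {r l : ℕ} (u : Fin (r + 1) → X) (e : Fin l → X) :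
    M.wordProb (Fin.append u e) = M.wordProb u * M.pathProb (u (Fin.last r)) e := by
  let x : ℕ → X := extend (u 0) (Fin.append u e)
  have hx : Fin.append u e = fun j : Fin (r + 1 + l) => x j := by
    ext j
    simp [x, extend]
  have hu : u = fun j : Fin (r + 1) => x j := by
    ext j
    have : u j = Fin.append u e (Fin.castAdd l j) := (Fin.append_left _ _ _).symm
    rw [this, hx]
    rfl
  have he : e = fun j : Fin l => x (r + (j + 1)) := by
    ext j
    have : e j = Fin.append u e (Fin.natAdd (r + 1) j) := (Fin.append_right _ _ _).symm
    rw [this, hx]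
    simp only [Fin.val_natAdd]
    congr 1
    omega
  have hl : u (Fin.last r) = x (r + 0) := by rw [hu]; rfl
  rw [hx, hl]
  conv_rhs => rw [hu, he]
  rw [M.wordProb_seq x (by omega), M.wordProb_seq x (by omega),
    M.pathProb_seq (fun j => x (r + j)), show r + 1 + l - 1 = r + l by omega,
    Finset.prod_range_add, mul_assoc]
  rfl

theorem expect_add_length (M : MarkovModel X) (a : X) (r l : ℕ) (F : (ℕ → X) → ℝ) :
    M.expect a (r + 1 + l) F = ∑ u : Fin (r + 1) → X, M.wordProb u *
      ∑ e : Fin l → X, M.pathProb (u (Fin.last r)) e * F (extend a (Fin.append u e)) := by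
  unfold expect
  rw [← (Fin.appendEquiv (r + 1) l).sum_comp, Fintype.sum_prod_type]
  simp only [Finset.mul_sum, ← mul_assoc, ← wordProb_append]
  rfl

theorem extend_append_eq {Y : Type*} (a : Y) {r l : ℕ} (u : Fin r → Y) (e : Fin l → Y) {i : ℕ} (hi : i < r) :
    extend a (Fin.append u e) i = extend a u i := by
  unfold extend
  rw [dif_pos (by omega), dif_pos hi]
  exact Fin.append_left u e ⟨i, hi⟩

/-- Consistency of the word distributions: letters that `F` does not see have conditional
probabilities summing to one. -/
theorem expect_eq_of_dependsOn (M : MarkovModel X) (a : X) {F : (ℕ → X) → ℝ} {r n : ℕ}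
    (hF : DependsOn F (Set.Iio r)) (hr : 0 < r) (hn : r ≤ n) :
    M.expect a n F = M.expect a r F := by
  obtain ⟨r, rfl⟩ := Nat.exists_eq_add_of_le' hr
  obtain ⟨l, rfl⟩ := Nat.exists_eq_add_of_le hn
  rw [expect_add_length]
  refine Finset.sum_congr rfl fun u _ => ?_
  have : ∀ e : Fin l → X, F (extend a (Fin.append u e)) = F (extend a u) := fun e =>
    hF fun i hi => extend_append_eq a u e hi
  simp only [this, ← Finset.sum_mul, M.pathProb_sum, one_mul]

/-- If `U` vanishes unless the window at `r` is `d`, and depends only on the letters up to the end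
of this window, then the window seen `l` positions later is distributed as `windowProb d · l`. -/
theorem expect_mul_window (M : MarkovModel X) (a : X) {K r l n : ℕ} (d : Fin (K + 1) → X)
    {U : (ℕ → X) → ℝ} (hU : DependsOn U (Set.Iio (r + K + 1)))
    (hd : ∀ x, U x ≠ 0 → (fun j : Fin (K + 1) => x (r + j)) = d) (hn : r + K + 1 + l ≤ n)
    (f : (Fin (K + 1) → X) → ℝ) :
    M.expect a n (fun x => U x * f fun j => x (r + l + j)) =
      M.expect a n fun x => U x * ∑ d', M.windowProb d d' l * f d' := by
  have hdep : DependsOn (fun x : ℕ → X => U x * f fun j => x (r + l + j))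
      (Set.Iio (r + K + 1 + l)) := by
    intro (x : ℕ → X) (y : ℕ → X) hxy
    simp only [Set.mem_Iio] at hxy
    have h1 : U x = U y := hU fun i hi => hxy i (by simp only [Set.mem_Iio] at hi; omega)
    have h2 : (fun j : Fin (K + 1) => x (r + l + j)) = fun j : Fin (K + 1) => y (r + l + j) := by
      ext j
      exact hxy _ (by omega)
    simp only [h1, h2]
  have hdep' : DependsOn (fun x : ℕ → X => U x * ∑ d', M.windowProb d d' l * f d')
      (Set.Iio (r + K + 1)) := by
    intro x y hxy
    simp only [hU hxy]
  rw [M.expect_eq_of_dependsOn a hdep (by omega) hn,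
    M.expect_eq_of_dependsOn a hdep' (by omega) (by omega), expect_add_length]
  -- The prefix `u` now ends exactly where the window at `r` ends. With `u` fixed, `U` is constant
  -- and only the `l` following letters are averaged.
  refine Finset.sum_congr rfl fun u _ => ?_
  congr 1
  have hUe : ∀ e : Fin l → X, U (extend a (Fin.append u e)) = U (extend a u) := fun e =>
    hU fun i hi => extend_append_eq a u e hi
  simp only [hUe]
  by_cases h0 : U (extend a u) = 0
  · simp [h0]
  have hd0 := hd _ h0
  have hlast : u (Fin.last (r + K)) = d (Fin.last K) := by
    rw [← hd0]
    simp [extend]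
    rfl
  have hwin : ∀ e : Fin l → X, (fun j : Fin (K + 1) => extend a (Fin.append u e) (r + l + j)) =
      fun j : Fin (K + 1) => Fin.append d e ⟨j + l, by omega⟩ := by
    intro e
    ext j
    unfold extend
    rw [dif_pos (by omega)]
    -- A letter of the shifted window lies either in the overlap with `d` or in the continuation
    -- `e`.
    by_cases hj : j.val + l < K + 1
    · have e1 : (⟨r + l + j, by omega⟩ : Fin (r + K + 1 + l)) =
          Fin.castAdd l ⟨r + l + j, by omega⟩ := rfl
      have e2 : (⟨j + l, by omega⟩ : Fin (K + 1 + l)) = Fin.castAdd l ⟨j + l, hj⟩ := rfl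
      rw [e1, e2, Fin.append_left, Fin.append_left, ← hd0]
      simp only [extend]
      rw [dif_pos (by omega)]
      congr 2
      omega
    · have e1 : (⟨r + l + j, by omega⟩ : Fin (r + K + 1 + l)) =
          Fin.natAdd (r + K + 1) ⟨j + l - (K + 1), by omega⟩ := by
        ext
        simp only [Fin.val_natAdd]
        omega
      have e2 : (⟨j + l, by omega⟩ : Fin (K + 1 + l)) =
          Fin.natAdd (K + 1) ⟨j + l - (K + 1), by omega⟩ := by
        ext
        simp only [Fin.val_natAdd]
        omega
      rw [e1, e2, Fin.append_right, Fin.append_right]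
  have hwp : ∑ d', M.windowProb d d' l * f d' = ∑ e : Fin l → X, M.pathProb (d (Fin.last K)) e *
      f fun j : Fin (K + 1) => Fin.append d e ⟨j + l, by omega⟩ := by
    unfold windowProb
    simp only [Finset.sum_mul, ite_mul, zero_mul]
    rw [Finset.sum_comm]
    simp
  rw [hwp, hlast, Finset.mul_sum]
  refine Finset.sum_congr rfl fun e _ => ?_
  rw [hwin]
  ring

end MarkovModel

namespace MatchingMachine

variable {A Q : Type*} {m : ℕ} {w : Fin m → A}

/-! ### Runs on infinite texts -/

/-- One iteration on the infinite text `y`. -/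
def step (M : MatchingMachine w Q) (y : ℕ → A) (c : Q × ℕ) : Q × ℕ :=
  (M.trans c.1 (y (c.2 + M.next c.1)), c.2 + M.shift c.1 (y (c.2 + M.next c.1)))

/-- The pair (state, position) at the beginning of iteration `i` on the infinite text `y`. -/
def run (M : MatchingMachine w Q) (y : ℕ → A) (i : ℕ) : Q × ℕ :=
  (M.step y)^[i] (M.init, 0)

theorem run_zero (M : MatchingMachine w Q) (y : ℕ → A) : M.run y 0 = (M.init, 0) := rfl

theorem run_succ (M : MatchingMachine w Q) (y : ℕ → A) (i : ℕ) :
    M.run y (i + 1) = M.step y (M.run y i) :=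
  Function.iterate_succ_apply' _ _ _

theorem config_eq_run (M : MatchingMachine w Q) (pad : EndConvention A) {n : ℕ} (t : Fin n → A)
    (i : ℕ) : M.config pad t i = M.run (letterAt pad t) i := by
  induction i with
  | zero => rfl
  | succ i ih =>
    rw [run_succ, ← ih]
    rfl

theorem run_pos_mono (M : MatchingMachine w Q) (y : ℕ → A) : Monotone fun i => (M.run y i).2 :=
  monotone_nat_of_le_succ fun i => by
    rw [run_succ]
    exact Nat.le_add_right _ _

theorem iterations_eq (M : MatchingMachine w Q) (pad : EndConvention A) {n : ℕ} (t : Fin n → A) :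
    M.iterations pad t = {i | (M.run (letterAt pad t) i).2 + m ≤ n} := by
  simp only [iterations, config_eq_run]

/-- The number of iterations on the infinite text `y` at positions `p` with `p + r ≤ n`. -/
noncomputable def count (M : MatchingMachine w Q) (y : ℕ → A) (r n : ℕ) : ℕ :=
  {i | (M.run y i).2 + r ≤ n}.ncard

theorem accesses_eq_count (M : MatchingMachine w Q) (pad : EndConvention A) {n : ℕ}
    (t : Fin n → A) : M.accesses pad t = M.count (letterAt pad t) m n := by
  rw [accesses, iterations_eq, count]

section Finite

variable [Fintype Q]

theorem next_le_order (M : MatchingMachine w Q) (q : Q) : M.next q ≤ M.order :=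
  Finset.le_sup (Finset.mem_univ q)

/-- Iteration `i` reads no further than its position plus the order, and earlier positions are no
larger. The read at `i` being covered, agreement extends to `i + 1`. -/
theorem run_congr (M : MatchingMachine w Q) {y y' : ℕ → A} {r i : ℕ}
    (hy : ∀ j < r, y j = y' j) (hi : (M.run y i).2 + M.order < r) :
    M.run y' i = M.run y i ∧ M.run y' (i + 1) = M.run y (i + 1) := by
  have hstep : ∀ i, (M.run y i).2 + M.order < r → M.run y' i = M.run y i →
      M.run y' (i + 1) = M.run y (i + 1) := by
    intro i hi h
    have := M.next_le_order (M.run y i).1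
    rw [run_succ, run_succ, h]
    unfold step
    rw [hy _ (by omega)]
  have h0 : M.run y' i = M.run y i := by
    induction i with
    | zero => rfl
    | succ i ih =>
      have := M.run_pos_mono y (Nat.le_add_right i 1)
      have hi' : (M.run y i).2 + M.order < r := by
        simp only at this
        omega
      exact hstep i hi' (ih hi')
  exact ⟨h0, hstep i hi h0⟩

/-- A run confined to positions at most `B` sees only the first `B + order + 1` letters. Planting
`w` right after them yields a text with the same run, which never reports that occurrence. -/
theorem IsValid.exists_lt_run_pos {M : MatchingMachine w Q} {pad : EndConvention A}
    (hM : M.IsValid pad) (y : ℕ → A) (B : ℕ) : ∃ i, B < (M.run y i).2 := by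
  by_contra! hB
  let t : Fin (B + M.order + 1 + m) → A := fun j =>
    if h : j.val < B + M.order + 1 then y j else w ⟨j - (B + M.order + 1), by omega⟩
  have hocc : OccursAt w t (B + M.order + 1) := by
    refine ⟨le_rfl, fun j => ?_⟩
    simp only [t]
    rw [dif_neg (by omega)]
    congr 1
    ext
    simp
  obtain ⟨i, -, hi, -⟩ := (hM _ t _).mpr hocc
  have hy : ∀ j < B + M.order + 1, y j = letterAt pad t j := by
    intro j hj
    simp only [letterAt, t]
    rw [dif_pos (by omega), dif_pos hj]
  have := hB i
  rw [config_eq_run, (M.run_congr hy (i := i) (by omega)).1] at hi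
  omega

/-- The position increases at least once in any `|Q|` consecutive iterations. -/
theorem IsValid.run_pos_lt {M : MatchingMachine w Q} {pad : EndConvention A}
    (hM : M.IsValid pad) (y : ℕ → A) (i : ℕ) :
    (M.run y i).2 < (M.run y (i + Fintype.card Q)).2 := by
  by_contra! hle
  have hmono := M.run_pos_mono y
  have hconst : ∀ j ≤ Fintype.card Q, (M.run y (i + j)).2 = (M.run y i).2 := by
    intro j hj
    have h1 : (M.run y i).2 ≤ (M.run y (i + j)).2 := hmono (Nat.le_add_right i j)
    have h2 : (M.run y (i + j)).2 ≤ (M.run y (i + Fintype.card Q)).2 :=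
      hmono (Nat.add_le_add_left hj i)
    omega
  -- Without progress, `|Q| + 1` configurations share one position, so two of them coincide.
  obtain ⟨a, b, hab, hq⟩ := Fintype.exists_ne_map_eq_of_card_lt
    (fun j : Fin (Fintype.card Q + 1) => (M.run y (i + j)).1) (by simp)
  -- A repeated configuration makes the run periodic, hence its position bounded.
  have key : ∀ a b : ℕ, a < b → M.run y a = M.run y b → False := by
    intro a b hab h
    have hper : ∀ k, M.run y (a + k * (b - a)) = M.run y a := by
      intro k
      induction k with
      | zero => simp
      | succ k ih =>
        have h1 : M.run y (b + k * (b - a)) = M.run y (a + k * (b - a)) := by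
          unfold run at h ⊢
          rw [add_comm b, add_comm a, Function.iterate_add_apply, Function.iterate_add_apply, h]
        rw [← ih, ← h1]
        congr 1
        rw [add_mul, one_mul]
        omega
    obtain ⟨k, hk⟩ := hM.exists_lt_run_pos y (M.run y a).2
    have h1 : (M.run y k).2 ≤ (M.run y (a + k * (b - a))).2 :=
      hmono (le_add_left (Nat.le_mul_of_pos_right k (by omega)))
    rw [hper] at h1
    omega
  have hrun : M.run y (i + a) = M.run y (i + b) :=
    Prod.ext hq ((hconst a (by omega)).trans (hconst b (by omega)).symm)
  rcases lt_or_gt_of_ne (fun h => hab (Fin.ext h) : a.val ≠ b.val) with h | h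
  · exact key _ _ (by omega) hrun
  · exact key _ _ (by omega) hrun.symm

theorem IsValid.le_run_pos {M : MatchingMachine w Q} {pad : EndConvention A}
    (hM : M.IsValid pad) (y : ℕ → A) (i k : ℕ) :
    (M.run y i).2 + k ≤ (M.run y (i + k * Fintype.card Q)).2 := by
  induction k with
  | zero => simp
  | succ k ih =>
    have := hM.run_pos_lt y (i + k * Fintype.card Q)
    rw [add_mul, one_mul, ← add_assoc i]
    omega

/-- Positions are monotone and unbounded, so `count` is the first iteration at which the position
bound fails. -/
theorem IsValid.setOf_run_pos_le {M : MatchingMachine w Q} {pad : EndConvention A}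
    (hM : M.IsValid pad) (y : ℕ → A) (r n : ℕ) :
    {i | (M.run y i).2 + r ≤ n} = Set.Iio (M.count y r n) := by
  have key : ∃ a, {i | (M.run y i).2 + r ≤ n} = Set.Iio a := by
    classical
    refine ⟨Nat.find ((hM.exists_lt_run_pos y n).imp fun i hi =>
      (by omega : n < (M.run y i).2 + r)), Set.ext fun i => ?_⟩
    rw [Set.mem_ofPred_eq, Set.mem_Iio, Nat.lt_find_iff]
    constructor
    · intro h j hj
      have : (M.run y j).2 ≤ (M.run y i).2 := M.run_pos_mono y hj
      omega
    · intro h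
      have := h i le_rfl
      omega
  obtain ⟨a, ha⟩ := key
  rw [count, ha, Set.ncard_eq_toFinset_card']
  simp

theorem IsValid.lt_count_iff {M : MatchingMachine w Q} {pad : EndConvention A}
    (hM : M.IsValid pad) (y : ℕ → A) {r n i : ℕ} :
    i < M.count y r n ↔ (M.run y i).2 + r ≤ n := by
  rw [← Set.mem_Iio, ← hM.setOf_run_pos_le]
  rfl

theorem IsValid.finite_iterations_and_accesses_pos {M : MatchingMachine w Q}
    {pad : EndConvention A} (hM : M.IsValid pad) {n : ℕ} (hn : m ≤ n) (t : Fin n → A) :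
    (M.iterations pad t).Finite ∧ 0 < M.accesses pad t := by
  rw [accesses_eq_count, iterations_eq, hM.setOf_run_pos_le, hM.lt_count_iff]
  exact ⟨Set.finite_Iio _, by simpa [run_zero] using hn⟩

theorem IsValid.count_le {M : MatchingMachine w Q} {pad : EndConvention A}
    (hM : M.IsValid pad) (y : ℕ → A) (r n : ℕ) :
    M.count y r n ≤ (n + 1) * Fintype.card Q := by
  by_contra! h
  rw [hM.lt_count_iff] at h
  have := hM.le_run_pos y 0 (n + 1)
  rw [zero_add] at this
  omega

theorem IsValid.lt_run_count {M : MatchingMachine w Q} {pad : EndConvention A}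
    (hM : M.IsValid pad) (y : ℕ → A) (r n : ℕ) : n < (M.run y (M.count y r n)).2 + r := by
  have := (hM.lt_count_iff y (r := r) (n := n)).not.mp (lt_irrefl (M.count y r n))
  omega

theorem IsValid.count_anti {M : MatchingMachine w Q} {pad : EndConvention A}
    (hM : M.IsValid pad) (y : ℕ → A) {r r' : ℕ} (hr : r ≤ r') (n : ℕ) :
    M.count y r' n ≤ M.count y r n := by
  by_contra! h
  rw [hM.lt_count_iff] at h
  have := hM.lt_run_count y r n
  omega

/-- After the exit for margin `r'`, another `r' * |Q|` iterations gain at least `r'` positions,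
which carries the run past `n`. -/
theorem IsValid.count_le_count_add {M : MatchingMachine w Q} {pad : EndConvention A}
    (hM : M.IsValid pad) (y : ℕ → A) (r r' n : ℕ) :
    M.count y r n ≤ M.count y r' n + r' * Fintype.card Q := by
  by_contra! h
  rw [hM.lt_count_iff] at h
  have h1 := hM.le_run_pos y (M.count y r' n) r'
  have h2 := hM.lt_run_count y r' n
  omega

/-- With a margin above the order, every counted iteration reads inside the first `n` letters, so
the end convention has no influence. -/
theorem count_congr (M : MatchingMachine w Q) {y y' : ℕ → A} {r n : ℕ} (hr : M.order < r)
    (hy : ∀ j < n, y j = y' j) : M.count y r n = M.count y' r n := by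
  unfold count
  congr 1
  ext i
  simp only [Set.mem_ofPred_eq]
  constructor
  · intro h
    rwa [(M.run_congr hy (by omega)).1]
  · intro h
    rwa [(M.run_congr (fun j hj => (hy j hj).symm) (by omega)).1]

variable [Fintype A]

/-- The greatest shift of the machine. -/
def maxShift (M : MatchingMachine w Q) : ℕ :=
  Finset.univ.sup fun c : Q × A => M.shift c.1 c.2

theorem shift_le_maxShift (M : MatchingMachine w Q) (q : Q) (x : A) : M.shift q x ≤ M.maxShift :=
  Finset.le_sup (f := fun c : Q × A => M.shift c.1 c.2) (Finset.mem_univ (q, x))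

theorem run_pos_succ_le (M : MatchingMachine w Q) (y : ℕ → A) (i : ℕ) :
    (M.run y (i + 1)).2 ≤ (M.run y i).2 + M.maxShift := by
  rw [run_succ]
  exact Nat.add_le_add_left (M.shift_le_maxShift _ _) _

theorem run_pos_le (M : MatchingMachine w Q) (y : ℕ → A) (i : ℕ) :
    (M.run y i).2 ≤ i * M.maxShift := by
  induction i with
  | zero => simp [run_zero]
  | succ i ih =>
    have := M.run_pos_succ_le y i
    rw [add_mul, one_mul]
    omega

theorem IsValid.lt_count_mul {M : MatchingMachine w Q} {pad : EndConvention A}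
    (hM : M.IsValid pad) (y : ℕ → A) (r n : ℕ) : n < M.count y r n * M.maxShift + r := by
  have h1 := hM.lt_run_count y r n
  have h2 := M.run_pos_le y (M.count y r n)
  omega

theorem IsValid.run_count_le {M : MatchingMachine w Q} {pad : EndConvention A}
    (hM : M.IsValid pad) (y : ℕ → A) {r n : ℕ} (ha : 0 < M.count y r n) :
    (M.run y (M.count y r n)).2 + r ≤ n + M.maxShift := by
  obtain ⟨a, ha'⟩ := Nat.exists_eq_succ_of_ne_zero ha.ne'
  rw [Nat.succ_eq_add_one] at ha'
  have h1 : (M.run y a).2 + r ≤ n := (hM.lt_count_iff y).mp (by omega)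
  have h2 := M.run_pos_succ_le y a
  rw [ha']
  omega

end Finite

end MatchingMachine

namespace MatchingMachine

variable {A Q S : Type*} {m : ℕ} {w : Fin m → A}

/-! ### The associated chain along an infinite sequence -/

/-- The position of the machine at the beginning of iteration `i` on the letters of `x`. -/
def posAt (M : MatchingMachine w Q) (x : ℕ → S × A) (i : ℕ) : ℕ :=
  (M.run (fun k => (x k).2) i).2

theorem posAt_mono (M : MatchingMachine w Q) (x : ℕ → S × A) : Monotone (M.posAt x) :=
  M.run_pos_mono _

section Finite

variable [Fintype Q]

/-- The state of the associated chain at the beginning of iteration `i` on `x`. -/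
def chainAt (M : MatchingMachine w Q) (x : ℕ → S × A) (i : ℕ) : M.ChainState S :=
  (fun j => x (M.posAt x i + j), (M.run (fun k => (x k).2) i).1)

/-- `F` is determined by the letters up to the end of the window of iteration `i`. -/
def DependsUpTo (M : MatchingMachine w Q) (i : ℕ) (F : (ℕ → S × A) → ℝ) : Prop :=
  ∀ x y, (∀ j < M.posAt x i + (M.order + 1), x j = y j) → F x = F y

theorem posAt_succ (M : MatchingMachine w Q) (x : ℕ → S × A) (i : ℕ) :
    M.posAt x (i + 1) = M.posAt x i + M.chainShift (M.chainAt x i) := by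
  unfold posAt
  rw [run_succ]
  rfl

theorem chainAt_succ (M : MatchingMachine w Q) (x : ℕ → S × A) (i : ℕ) :
    M.chainAt x (i + 1) = (fun j : Fin (M.order + 1) => x (M.posAt x i + M.chainShift (M.chainAt x i) + j),
      M.trans (M.chainAt x i).2 (M.chainLetter (M.chainAt x i))) := by
  refine Prod.ext ?_ ?_
  · ext1 j
    simp only [← posAt_succ]
    rfl
  · unfold chainAt
    rw [run_succ]
    rfl

theorem posAt_eq_sum (M : MatchingMachine w Q) (x : ℕ → S × A) (i : ℕ) :
    M.posAt x i = ∑ j ∈ Finset.range i, M.chainShift (M.chainAt x j) := by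
  induction i with
  | zero => rfl
  | succ i ih => rw [posAt_succ, Finset.sum_range_succ, ih]

/-- The end of the window at iteration `i` acts as a stopping time: agreement up to the value
computed from `x` forces the same value for `y`. This makes `DependsUpTo` behave as a filtration. -/
theorem run_eq_of_agree (M : MatchingMachine w Q) {x y : ℕ → S × A} {i j : ℕ} (hji : j ≤ i)
    (h : ∀ k < M.posAt x i + (M.order + 1), x k = y k) :
    M.posAt x j = M.posAt y j ∧ M.chainAt x j = M.chainAt y j := by
  have hmono := M.posAt_mono x hji
  have hrun : M.run (fun k => (y k).2) j = M.run (fun k => (x k).2) j :=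
    (M.run_congr (r := M.posAt x i + (M.order + 1)) (fun k hk => congrArg Prod.snd (h k hk))
      (by unfold posAt at hmono ⊢; omega)).1
  have hpos : M.posAt x j = M.posAt y j := by rw [posAt, posAt, hrun]
  refine ⟨hpos, Prod.ext ?_ ?_⟩
  · ext1 k
    simp only [chainAt, ← hpos]
    exact h _ (by omega)
  · simp only [chainAt, hrun]

theorem dependsUpTo_chainAt (M : MatchingMachine w Q) {i j : ℕ} (hji : j ≤ i)
    (g : M.ChainState S → ℝ) : M.DependsUpTo i fun x => g (M.chainAt x j) := fun x y h => by
  simp only [(M.run_eq_of_agree hji h).2]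

variable [Fintype A]

theorem posAt_le (M : MatchingMachine w Q) (x : ℕ → S × A) (i : ℕ) :
    M.posAt x i ≤ i * M.maxShift :=
  M.run_pos_le _ i

variable [Fintype S]

theorem op_chain_apply (M : MatchingMachine w Q) (H : HMM S A) (g : M.ChainState S → ℝ)
    (c : M.ChainState S) : (M.chain H).op g c =
      ∑ d', H.split.windowProb c.1 d' (M.chainShift c) *
        g (d', M.trans c.2 (M.chainLetter c)) := by
  classical
  simp [MarkovModel.op_apply, chain, Fintype.sum_prod_type]

/-- The Markov property of the associated chain. -/
theorem expect_mul_chainAt_succ (M : MatchingMachine w Q) (H : HMM S A) (a : S × A)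
    {i N : ℕ} (hN : (i + 1) * M.maxShift + (M.order + 1) ≤ N) {F : (ℕ → S × A) → ℝ}
    (hF : M.DependsUpTo i F) (g : M.ChainState S → ℝ) :
    H.split.expect a N (fun x => F x * g (M.chainAt x (i + 1))) =
      H.split.expect a N fun x => F x * (M.chain H).op g (M.chainAt x i) := by
  classical
  -- Restricting to a given position `p` and chain state `c` makes the random end of the window
  -- deterministic, so that `expect_mul_window` applies to each piece.
  let U : ℕ → M.ChainState S → (ℕ → S × A) → ℝ := fun p c x =>
    if M.posAt x i = p then (if M.chainAt x i = c then F x else 0) else 0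
  have hsplit : ∀ x (b : ℝ), F x * b =
      ∑ p ∈ Finset.range (i * M.maxShift + 1), ∑ c, U p c x * b := by
    intro x b
    simp only [← Finset.sum_mul, U]
    congr 1
    have : ∀ p, (∑ c, if M.posAt x i = p then (if M.chainAt x i = c then F x else 0) else 0) =
        if M.posAt x i = p then F x else 0 := by
      intro p
      split_ifs <;> simp
    simp only [this]
    rw [Finset.sum_ite_eq, if_pos]
    exact Finset.mem_range.mpr (Nat.lt_succ_of_le (M.posAt_le x i))
  simp only [hsplit]
  simp only [MarkovModel.expect_sum]
  refine Finset.sum_congr rfl fun p hp => Finset.sum_congr rfl fun c _ => ?_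
  have hp' := Finset.mem_range.mp hp
  have hU0 : ∀ x : ℕ → S × A, U p c x ≠ 0 → M.posAt x i = p ∧ M.chainAt x i = c := by
    intro x hx
    simp only [U] at hx
    split_ifs at hx with h1 h2
    · exact ⟨h1, h2⟩
    · exact absurd rfl hx
    · exact absurd rfl hx
  have hUdep : DependsOn (U p c) (Set.Iio (p + M.order + 1)) := by
    intro (x : ℕ → S × A) (y : ℕ → S × A) hxy
    have key : ∀ x y : ℕ → S × A, (∀ k < p + (M.order + 1), x k = y k) → M.posAt x i = p →
        U p c x = U p c y := by
      intro x y hxy hp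
      have hxy' : ∀ k < M.posAt x i + (M.order + 1), x k = y k := by rwa [hp]
      have := M.run_eq_of_agree le_rfl hxy'
      simp only [U]
      rw [← this.1, ← this.2, hF x y hxy']
    by_cases hx : M.posAt x i = p
    · exact key x y (fun k hk => hxy k hk) hx
    · by_cases hy : M.posAt y i = p
      · exact (key y x (fun k hk => (hxy k hk).symm) hy).symm
      · simp only [U, if_neg hx, if_neg hy]
  have hl : M.chainShift c ≤ M.maxShift := M.shift_le_maxShift _ _
  have hwin := H.split.expect_mul_window a (r := p) (l := M.chainShift c) (n := N) c.1 hUdep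
    (fun x hx => by
      obtain ⟨h1, h2⟩ := hU0 x hx
      rw [← h2, ← h1]
      rfl)
    (by rw [add_mul, one_mul] at hN; omega)
    (fun d' => g (d', M.trans c.2 (M.chainLetter c)))
  rw [← op_chain_apply] at hwin
  convert hwin using 2
  · ext x
    by_cases hx : U p c x = 0
    · simp [hx]
    · obtain ⟨h1, h2⟩ := hU0 x hx
      rw [chainAt_succ, h1, h2]
  · ext x
    by_cases hx : U p c x = 0
    · simp [hx]
    · rw [(hU0 x hx).2]

/-- The parsed sequence has the one-time marginals of the associated chain: the Markov property with
constant past peels off one operator per iteration, down to the first window. -/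
theorem expect_chainAt (M : MatchingMachine w Q) (H : HMM S A) (a : S × A) {i N : ℕ}
    (hN : i * M.maxShift + (M.order + 1) ≤ N) (g : M.ChainState S → ℝ) :
    H.split.expect a N (fun x => g (M.chainAt x i)) =
      (M.chain H).initMean (((M.chain H).op ^ i) g) := by
  classical
  induction i generalizing g with
  | zero =>
    have hdep : DependsOn (fun x : ℕ → S × A => g (M.chainAt x 0)) (Set.Iio (M.order + 1)) :=
      fun x y hxy => M.dependsUpTo_chainAt le_rfl g x y fun j hj =>
        hxy j (by simpa [posAt, run_zero] using hj)
    rw [H.split.expect_eq_of_dependsOn a hdep (by omega) (by omega)]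
    simp only [MarkovModel.initMean_apply, chain, MarkovModel.expect, Fintype.sum_prod_type,
      pow_zero, Module.End.one_apply, ite_mul, zero_mul, Finset.sum_ite_eq', Finset.mem_univ,
      if_true]
    refine Finset.sum_congr rfl fun u _ => ?_
    congr 2
    refine Prod.ext ?_ rfl
    ext1 j
    simp only [chainAt, posAt, run_zero, MarkovModel.extend, zero_add]
    rw [dif_pos j.isLt]
  | succ i ih =>
    have h1 := M.expect_mul_chainAt_succ H a hN (F := fun _ => 1) (fun _ _ _ => rfl) g
    simp only [one_mul] at h1
    rw [h1, ih (by rw [add_mul, one_mul] at hN; omega), pow_succ, Module.End.mul_apply]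

/-- Increments of the martingale obtained from a harmonic function are orthogonal to its past. -/
theorem expect_mul_harmonic (M : MatchingMachine w Q) (H : HMM S A) (a : S × A) {L i N : ℕ}
    (hLi : L ≤ i) (hN : i * M.maxShift + (M.order + 1) ≤ N) {h : M.ChainState S → ℝ}
    (hh : (M.chain H).op h = h) :
    H.split.expect a N (fun x => h (M.chainAt x L) * h (M.chainAt x i)) =
      H.split.expect a N fun x => h (M.chainAt x L) * h (M.chainAt x L) := by
  induction i, hLi using Nat.le_induction with
  | base => rfl
  | succ i hLi ih =>
    rw [M.expect_mul_chainAt_succ H a hN (M.dependsUpTo_chainAt hLi h), hh,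
      ih (by rw [add_mul, one_mul] at hN; omega)]

/-- Orthogonality of martingale increments. Written through the operator, the second moments no
longer depend on `N`. -/
theorem expect_sq_harmonic_sub (M : MatchingMachine w Q) (H : HMM S A) (a : S × A) {L i N : ℕ}
    (hLi : L ≤ i) (hN : i * M.maxShift + (M.order + 1) ≤ N) {h : M.ChainState S → ℝ}
    (hh : (M.chain H).op h = h) :
    H.split.expect a N (fun x => (h (M.chainAt x i) - h (M.chainAt x L)) ^ 2) =
      (M.chain H).initMean (((M.chain H).op ^ i) fun c => h c ^ 2) -
        (M.chain H).initMean (((M.chain H).op ^ L) fun c => h c ^ 2) := by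
  have hN' : L * M.maxShift + (M.order + 1) ≤ N :=
    (Nat.add_le_add_right (Nat.mul_le_mul_right _ hLi) _).trans hN
  rw [← M.expect_chainAt H a hN, ← M.expect_chainAt H a hN']
  have h1 := M.expect_mul_harmonic H a hLi hN hh
  have h2 : (fun x : ℕ → S × A => (h (M.chainAt x i) - h (M.chainAt x L)) ^ 2) = fun x =>
      (h (M.chainAt x i) ^ 2 + h (M.chainAt x L) * h (M.chainAt x L)) -
        2 * (h (M.chainAt x L) * h (M.chainAt x i)) := by
    ext x
    ring
  rw [h2, MarkovModel.expect_sub, MarkovModel.expect_mul_left, MarkovModel.expect_add, h1]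
  simp only [sq]
  ring

/-- The martingale obtained from a harmonic function is a Cauchy sequence in mean square. -/
theorem exists_expect_sq_harmonic_sub_le (M : MatchingMachine w Q) (H : HMM S A) (a : S × A)
    {h : M.ChainState S → ℝ} (hh : (M.chain H).op h = h) {ε : ℝ} (hε : 0 < ε) :
    ∃ L, ∀ i N, L ≤ i → i * M.maxShift + (M.order + 1) ≤ N →
      H.split.expect a N (fun x => (h (M.chainAt x i) - h (M.chainAt x L)) ^ 2) ≤ ε := by
  let b : ℕ → ℝ := fun i => (M.chain H).initMean (((M.chain H).op ^ i) fun c => h c ^ 2)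
  have hbdd : BddAbove (Set.range b) := by
    obtain ⟨B, -, hB⟩ := MarkovModel.exists_abs_le fun c => h c ^ 2
    refine ⟨B, ?_⟩
    rintro _ ⟨i, rfl⟩
    exact (le_abs_self _).trans ((M.chain H).abs_initMean_le ((M.chain H).abs_op_pow_le hB i))
  -- The second moments are bounded; once `b L` is within `ε` of their supremum, no later one
  -- exceeds it by more than `ε`.
  obtain ⟨L, hL⟩ := exists_lt_of_lt_ciSup (sub_lt_self (⨆ i, b i) hε)
  refine ⟨L, fun i N hi hN => ?_⟩
  rw [M.expect_sq_harmonic_sub H a hi hN hh]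
  have : b i ≤ ⨆ i, b i := le_ciSup hbdd i
  simp only [b] at hL this
  linarith

/-- The fluctuations of the chain, summed as long as the position is at most `n - r`, are of the
order of the square root of the number of iterations. -/
theorem expect_sq_fluctuation_le (M : MatchingMachine w Q) (H : HMM S A) (a : S × A)
    {g : M.ChainState S → ℝ} {B : ℝ} (hB : ∀ c, |g c| ≤ B) (r n k N : ℕ)
    (hN : k * M.maxShift + (M.order + 1) ≤ N) :
    H.split.expect a N (fun x => (∑ i ∈ Finset.range k, if M.posAt x i + r ≤ n then
      g (M.chainAt x (i + 1)) - (M.chain H).op g (M.chainAt x i) else 0) ^ 2) ≤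
        k * (2 * B) ^ 2 := by
  induction k with
  | zero => simp [MarkovModel.expect_const]
  | succ k ih =>
    let D : (ℕ → S × A) → ℝ := fun x => if M.posAt x k + r ≤ n then
      g (M.chainAt x (k + 1)) - (M.chain H).op g (M.chainAt x k) else 0
    let Z : (ℕ → S × A) → ℝ := fun x => ∑ i ∈ Finset.range k, if M.posAt x i + r ≤ n then
      g (M.chainAt x (i + 1)) - (M.chain H).op g (M.chainAt x i) else 0
    let V : (ℕ → S × A) → ℝ := fun x => if M.posAt x k + r ≤ n then Z x else 0
    have hV : M.DependsUpTo k V := by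
      intro x y hxy
      have hZ : Z x = Z y := by
        refine Finset.sum_congr rfl fun i hi => ?_
        have hi' := Finset.mem_range.mp hi
        have h1 := M.run_eq_of_agree hi'.le hxy
        have h2 := M.run_eq_of_agree (Nat.succ_le_of_lt hi') hxy
        rw [h1.1, h1.2, h2.2]
      simp only [V]
      rw [hZ, (M.run_eq_of_agree le_rfl hxy).1]
    have hcross : H.split.expect a N (fun x => Z x * D x) = 0 := by
      have h1 := M.expect_mul_chainAt_succ H a hN hV g
      have h2 : (fun x => Z x * D x) = fun x => V x * g (M.chainAt x (k + 1)) -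
          V x * (M.chain H).op g (M.chainAt x k) := by
        ext x
        simp only [D, V]
        split_ifs <;> ring
      rw [h2, MarkovModel.expect_sub, h1, sub_self]
    have hD : ∀ x, D x ^ 2 ≤ (2 * B) ^ 2 := by
      intro x
      refine sq_le_sq' ?_ ?_ <;>
      · have h1 := abs_le.mp (hB (M.chainAt x (k + 1)))
        have h2 := abs_le.mp ((M.chain H).abs_op_le hB (M.chainAt x k))
        simp only [D]
        split_ifs <;> linarith
    have hsum : (fun x => (∑ i ∈ Finset.range (k + 1), if M.posAt x i + r ≤ n then
        g (M.chainAt x (i + 1)) - (M.chain H).op g (M.chainAt x i) else 0) ^ 2) = fun x =>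
        Z x ^ 2 + (2 * (Z x * D x) + D x ^ 2) := by
      ext x
      rw [Finset.sum_range_succ]
      simp only [Z, D]
      ring
    rw [hsum, MarkovModel.expect_add, MarkovModel.expect_add, MarkovModel.expect_mul_left, hcross]
    have h1 := ih (by rw [add_mul, one_mul] at hN; omega)
    have h2 : H.split.expect a N (fun x => D x ^ 2) ≤ (2 * B) ^ 2 :=
      (MarkovModel.expect_mono hD).trans_eq (H.split.expect_const a N _)
    push_cast
    linarith

end Finite

end MatchingMachine

/-! ### Text probabilities as marginals of the split model -/

namespace HMM

variable {S A : Type*} [Fintype S] [Fintype A]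

/-- The probability of a text is the sum over the sequences of hidden states of the probabilities
of the words of pairs (hidden state, letter). -/
theorem textProb_eq_sum (H : HMM S A) {n : ℕ} (t : Fin n → A) :
    H.textProb t = ∑ z : Fin n → S, H.split.wordProb fun i => (z i, t i) := by
  cases n with
  | zero => simp [textProb, MarkovModel.wordProb]
  | succ n =>
    refine Finset.sum_congr rfl fun z _ => ?_
    simp only [MarkovModel.wordProb, MarkovModel.pathProb]
    rw [show (Fin.cons (z 0, t 0) (Fin.tail fun i => (z i, t i)) : Fin (n + 1) → S × A) =
      fun i => (z i, t i) from Fin.cons_self_tail fun i => (z i, t i)]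
    rfl

theorem sum_mul_textProb (H : HMM S A) {n : ℕ} (f : (Fin n → A) → ℝ) :
    ∑ t, f t * H.textProb t =
      ∑ u : Fin n → S × A, H.split.wordProb u * f fun i => (u i).2 := by
  simp only [textProb_eq_sum, Finset.mul_sum]
  rw [Finset.sum_comm, ← Fintype.sum_prod_type',
    ← (Equiv.arrowProdEquivProdArrow (Fin n) (fun _ => S) (fun _ => A)).sum_comp]
  exact Finset.sum_congr rfl fun u _ => mul_comm _ _

end HMM

/-! ### Comparison of the ratio with the mean shift, and convergence -/

namespace MatchingMachine

variable {A Q S : Type*} [Fintype Q] {m : ℕ} {w : Fin m → A}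

/-- A distance from the end of a text beyond which no access is past the end. -/
def margin (M : MatchingMachine w Q) : ℕ := max (M.order + 1) m

variable [Fintype A]

/-- On a text of length `n`, the ratio of the length to the number of accesses differs by `O(1/n)`
from the mean shift over the iterations far enough from the end of the text. -/
theorem IsValid.abs_ratio_sub_le {M : MatchingMachine w Q} {pad : EndConvention A}
    (hM : M.IsValid pad) : ∃ C : ℝ, ∀ (n : ℕ) (t : Fin n → A) (y : ℕ → A),
      2 * M.margin ≤ n → (∀ j : Fin n, y j = t j) →
      |(n : ℝ) / M.accesses pad t -
        (M.run y (M.count y M.margin n)).2 / M.count y M.margin n| ≤ C / n := by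
  set G : ℝ := (M.maxShift : ℝ) with hG
  set R : ℝ := (M.margin : ℝ) with hR
  set k : ℝ := (Fintype.card Q : ℝ) with hk
  refine ⟨(2 * G * (R * k) + (R + G)) * (2 * G), fun n t y hn hy => ?_⟩
  have hr : M.order < M.margin := Nat.lt_of_succ_le (le_max_left _ _)
  have hm : m ≤ M.margin := le_max_right _ _
  set y' := letterAt pad t with hy'
  have hagree : ∀ j < n, y' j = y j := fun j hj => by
    rw [hy', letterAt, dif_pos hj]
    exact (hy ⟨j, hj⟩).symm
  have hcongr := M.count_congr hr hagree
  rw [accesses_eq_count, ← hy']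
  have h1 := hM.count_anti y' hm n
  have h2 := hM.count_le_count_add y' m M.margin n
  rw [hcongr] at h1 h2
  have h3 := hM.lt_count_mul y M.margin n
  have h4 := hM.lt_run_count y M.margin n
  have ha : 0 < M.count y M.margin n := by
    rcases Nat.eq_zero_or_pos (M.count y M.margin n) with h | h
    · rw [h] at h3
      omega
    · exact h
  have h5 := hM.run_count_le y ha
  set a := M.count y M.margin n
  set b := M.count y' m n
  set p := (M.run y a).2
  have hn0 : (0 : ℝ) < n := by
    have : 0 < n := by omega
    exact_mod_cast this
  have ha0 : (0 : ℝ) < a := by exact_mod_cast ha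
  have h1' : (a : ℝ) ≤ b := by exact_mod_cast h1
  have h2' : (b : ℝ) ≤ a + R * k := by
    rw [hR, hk]
    exact_mod_cast h2
  have h3' : (n : ℝ) ≤ 2 * (a * G) := by
    rw [hG]
    have : n ≤ 2 * (a * M.maxShift) := by omega
    exact_mod_cast this
  have h4' : (n : ℝ) ≤ p + R := by
    rw [hR]
    exact_mod_cast h4.le
  have h5' : (p : ℝ) + R ≤ n + G := by
    rw [hR, hG]
    exact_mod_cast h5
  have hb0 : (0 : ℝ) < b := lt_of_lt_of_le ha0 h1'
  have hR0 : 0 ≤ R := Nat.cast_nonneg _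
  have hG0 : 0 ≤ G := Nat.cast_nonneg _
  have hk0 : 0 ≤ k := Nat.cast_nonneg _
  have hinv : 1 / (a : ℝ) ≤ 2 * G / n := by
    rw [div_le_div_iff₀ ha0 hn0]
    linarith
  have e1 : |(n : ℝ) / b - n / a| ≤ 2 * G * (R * k) * (1 / a) := by
    have : (n : ℝ) / b - n / a = -((n / b) * ((b - a) * (1 / a))) := by
      field_simp
      ring
    rw [this, abs_neg, abs_mul, abs_mul, abs_of_nonneg (by positivity : (0 : ℝ) ≤ n / b),
      abs_of_nonneg (by linarith : (0 : ℝ) ≤ b - a), abs_of_nonneg (by positivity : 0 ≤ 1 / (a : ℝ)),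
      mul_assoc (2 * G)]
    have : (n : ℝ) / b ≤ 2 * G := by
      rw [div_le_iff₀ hb0]
      have := mul_le_mul_of_nonneg_right h1' hG0
      linarith
    gcongr
    linarith
  have e2 : |(n : ℝ) / a - p / a| ≤ (R + G) * (1 / a) := by
    rw [← sub_div, abs_div, abs_of_pos ha0, div_eq_mul_one_div]
    gcongr
    rw [abs_le]
    constructor <;> linarith
  calc |(n : ℝ) / b - p / a| ≤ |(n : ℝ) / b - n / a| + |(n : ℝ) / a - p / a| := abs_sub_le _ _ _
    _ ≤ (2 * G * (R * k) + (R + G)) * (1 / a) := by rw [add_mul]; exact add_le_add e1 e2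
    _ ≤ (2 * G * (R * k) + (R + G)) * (2 * G / n) := by gcongr
    _ = _ := by ring

variable [Fintype S]

/-- The mean shift over the first iterations, compared with the value at iteration `L` of the
harmonic part of the shift function. -/
theorem IsValid.abs_mean_shift_sub_le {M : MatchingMachine w Q} {pad : EndConvention A}
    (hM : M.IsValid pad) (H : HMM S A) {h g : M.ChainState S → ℝ}
    (hhg : (fun c => (M.chainShift c : ℝ)) = h + (g - (M.chain H).op g)) {B : ℝ}
    (hB : ∀ c, |g c| ≤ B) {n : ℕ} (hn : 2 * M.margin ≤ n) (L : ℕ) (x : ℕ → S × A) :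
    |(M.posAt x (M.count (fun k => (x k).2) M.margin n) : ℝ) /
        M.count (fun k => (x k).2) M.margin n - h (M.chainAt x L)| ≤
      2 * M.maxShift / n *
        (∑ i ∈ Finset.range ((n + 1) * Fintype.card Q), |h (M.chainAt x i) - h (M.chainAt x L)| +
        |∑ i ∈ Finset.range ((n + 1) * Fintype.card Q), if M.posAt x i + M.margin ≤ n then
          g (M.chainAt x (i + 1)) - (M.chain H).op g (M.chainAt x i) else 0| + 2 * B) := by
  set y : ℕ → A := fun k => (x k).2
  have hr : M.order < M.margin := Nat.lt_of_succ_le (le_max_left _ _)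
  have h3 := hM.lt_count_mul y M.margin n
  have ha : 0 < M.count y M.margin n := by
    rcases Nat.eq_zero_or_pos (M.count y M.margin n) with h | h
    · rw [h] at h3
      omega
    · exact h
  have hak := hM.count_le y M.margin n
  have hlt : ∀ i, M.posAt x i + M.margin ≤ n ↔ i < M.count y M.margin n := fun i =>
    (hM.lt_count_iff y).symm
  set a := M.count y M.margin n
  set k := (n + 1) * Fintype.card Q
  have hn0 : (0 : ℝ) < n := by
    have : 0 < n := by omega
    exact_mod_cast this
  have ha0 : (0 : ℝ) < a := by exact_mod_cast ha
  have hinv : 1 / (a : ℝ) ≤ 2 * M.maxShift / n := by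
    rw [div_le_div_iff₀ ha0 hn0]
    have : n ≤ 2 * (a * M.maxShift) := by omega
    have : (n : ℝ) ≤ 2 * (a * M.maxShift) := by exact_mod_cast this
    linarith
  -- As `k` bounds every possible count, the indicator turns the sum up to the random time `a` into
  -- one over a deterministic range.
  have hfluct : (∑ i ∈ Finset.range k, if M.posAt x i + M.margin ≤ n then
      g (M.chainAt x (i + 1)) - (M.chain H).op g (M.chainAt x i) else 0) =
      ∑ i ∈ Finset.range a, (g (M.chainAt x (i + 1)) - (M.chain H).op g (M.chainAt x i)) := by
    simp only [hlt]
    rw [← Finset.sum_filter]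
    congr 1
    ext i
    simp only [Finset.mem_filter, Finset.mem_range]
    omega
  rw [hfluct]
  set Z := ∑ i ∈ Finset.range a, (g (M.chainAt x (i + 1)) - (M.chain H).op g (M.chainAt x i))
    with hZ
  -- Replacing `g (c_i)` by `g (c_{i+1})` in each coboundary term creates the martingale increment
  -- and leaves a telescoping sum.
  have hpos : (M.posAt x a : ℝ) - a * h (M.chainAt x L) =
      ∑ i ∈ Finset.range a, (h (M.chainAt x i) - h (M.chainAt x L)) + Z +
        (g (M.chainAt x 0) - g (M.chainAt x a)) := by
    have hφ : ∀ c, (M.chainShift c : ℝ) = h c + (g c - (M.chain H).op g c) := congrFun hhg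
    rw [posAt_eq_sum]
    push_cast
    simp only [hφ, hZ, Finset.sum_add_distrib, Finset.sum_sub_distrib, Finset.sum_const,
      Finset.card_range, nsmul_eq_mul]
    have := Finset.sum_range_sub (fun i => g (M.chainAt x i)) a
    rw [Finset.sum_sub_distrib] at this
    linarith
  have hdiv : (M.posAt x a : ℝ) / a - h (M.chainAt x L) =
      1 / a * ((M.posAt x a : ℝ) - a * h (M.chainAt x L)) := by
    field_simp
  rw [hdiv, abs_mul, abs_of_nonneg (by positivity : 0 ≤ 1 / (a : ℝ)), hpos]
  have hsum : |∑ i ∈ Finset.range a, (h (M.chainAt x i) - h (M.chainAt x L))| ≤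
      ∑ i ∈ Finset.range k, |h (M.chainAt x i) - h (M.chainAt x L)| :=
    (Finset.abs_sum_le_sum_abs _ _).trans (Finset.sum_le_sum_of_subset_of_nonneg
      (Finset.range_subset_range.mpr hak) fun _ _ _ => abs_nonneg _)
  have hg : |g (M.chainAt x 0) - g (M.chainAt x a)| ≤ 2 * B := by
    have h1 := abs_sub (g (M.chainAt x 0)) (g (M.chainAt x a))
    have h2 := hB (M.chainAt x 0)
    have h4 := hB (M.chainAt x a)
    linarith
  refine mul_le_mul hinv ?_ (abs_nonneg _) (by positivity)
  exact (abs_add_three _ _ _).trans (by gcongr)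

/-- Used in place of Cauchy-Schwarz to pass from mean square to mean absolute value, with a free
scale `d`. -/
theorem abs_le_add_sq_div {b d : ℝ} (hd : 0 < d) : |b| ≤ d + 1 / d * b ^ 2 := by
  have h1 : |b| * d ≤ d ^ 2 + b ^ 2 := by
    rw [← sq_abs b]
    nlinarith [sq_nonneg (|b| - d), abs_nonneg b]
  calc |b| = |b| * d / d := by field_simp
    _ ≤ (d ^ 2 + b ^ 2) / d := by gcongr
    _ = d + 1 / d * b ^ 2 := by field_simp

theorem IsValid.tendsto_expectedRatio {M : MatchingMachine w Q} {pad : EndConvention A}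
    (hM : M.IsValid pad) (H : HMM S A) {h g : M.ChainState S → ℝ} (hh : (M.chain H).op h = h)
    (hhg : (fun c => (M.chainShift c : ℝ)) = h + (g - (M.chain H).op g)) :
    Tendsto (fun n : ℕ => M.expectedRatio pad H n) atTop (𝓝 ((M.chain H).initMean h)) := by
  obtain ⟨a⟩ : Nonempty (S × A) := by
    by_contra hne
    rw [not_nonempty_iff] at hne
    have := H.split.init_sum
    simp at this
  have hr : M.order < M.margin := Nat.lt_of_succ_le (le_max_left _ _)
  obtain ⟨C, hC⟩ := hM.abs_ratio_sub_le
  obtain ⟨B, hB0, hB⟩ := MarkovModel.exists_abs_le g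
  obtain ⟨B', hB'0, hB'⟩ := MarkovModel.exists_abs_le h
  set q : ℝ := (Fintype.card Q : ℝ) with hq
  set G : ℝ := (M.maxShift : ℝ) with hG
  have hq0 : 0 ≤ q := Nat.cast_nonneg _
  have hG0 : 0 ≤ G := Nat.cast_nonneg _
  -- `L` is chosen from `ε` before `n` grows. After multiplication by `2 * G / n`, the at most `2 *
  -- q * n` harmonic terms of size `2 * ε` give the `4 * q`, and the fluctuation gives the `1`.
  have main : ∀ ε > 0, ∃ C' : ℝ, ∀ n : ℕ, 2 * M.margin ≤ n →
      |M.expectedRatio pad H n - (M.chain H).initMean h| ≤ 2 * G * (4 * q + 1) * ε + C' / n := by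
    intro ε hε
    obtain ⟨L, hL⟩ := M.exists_expect_sq_harmonic_sub_le H a hh (ε := ε ^ 2) (by positivity)
    refine ⟨C + 2 * G * (2 * B' * L + 8 * q * B ^ 2 / ε + 2 * B), fun n hn => ?_⟩
    set k := (n + 1) * Fintype.card Q with hk
    -- Long enough for the windows of all iterations up to `k + L` and for the text itself.
    set N := (k + L) * M.maxShift + (M.order + 1) + n with hN
    have hNi : ∀ i ≤ k + L, i * M.maxShift + (M.order + 1) ≤ N := fun i hi => by
      have := Nat.mul_le_mul_right M.maxShift hi
      omega
    have hn1 : (1 : ℝ) ≤ n := by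
      have : 1 ≤ n := by omega
      exact_mod_cast this
    have hn0 : (0 : ℝ) < n := by linarith
    have hkn : (k : ℝ) ≤ 2 * q * n := by
      rw [hk]
      push_cast
      nlinarith
    let E := H.split.expect a N
    let ratio : (ℕ → S × A) → ℝ := fun x => (n : ℝ) / M.accesses pad fun i : Fin n => (x i).2
    let mean : (ℕ → S × A) → ℝ := fun x =>
      (M.posAt x (M.count (fun k => (x k).2) M.margin n) : ℝ) /
        M.count (fun k => (x k).2) M.margin n
    let Z : (ℕ → S × A) → ℝ := fun x => ∑ i ∈ Finset.range k, if M.posAt x i + M.margin ≤ n then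
      g (M.chainAt x (i + 1)) - (M.chain H).op g (M.chainAt x i) else 0
    have hratio : M.expectedRatio pad H n = E ratio := by
      have hdep : DependsOn ratio (Set.Iio n) := by
        intro (x : ℕ → S × A) (y : ℕ → S × A) hxy
        have : (fun i : Fin n => (x i).2) = fun i : Fin n => (y i).2 := by
          ext1 i
          rw [hxy i i.isLt]
        simp only [ratio, this]
      simp only [E]
      rw [H.split.expect_eq_of_dependsOn a hdep (by omega) (by omega), expectedRatio,
        H.sum_mul_textProb]
      refine Finset.sum_congr rfl fun u _ => ?_
      simp only [ratio, MarkovModel.extend, Fin.is_lt, dif_pos, Fin.eta]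
    have hmean : E (fun x => h (M.chainAt x L)) = (M.chain H).initMean h := by
      simp only [E]
      rw [M.expect_chainAt H a (hNi L (by omega)), (M.chain H).op_pow_of_harmonic hh]
    have hterm : ∀ i < k, E (fun x => |h (M.chainAt x i) - h (M.chainAt x L)|) ≤
        (if i < L then 2 * B' else 0) + 2 * ε := by
      intro i hi
      split_ifs with hiL
      -- Before `L` only the trivial bound is available, but there are at most `L` such terms.
      · refine (MarkovModel.expect_mono (G := fun _ => 2 * B') fun x => ?_).trans ?_
        · have h1 := abs_sub (h (M.chainAt x i)) (h (M.chainAt x L))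
          have h2 := hB' (M.chainAt x i)
          have h3 := hB' (M.chainAt x L)
          linarith
        · rw [MarkovModel.expect_const]
          linarith
      · refine (MarkovModel.expect_mono fun x => abs_le_add_sq_div hε).trans ?_
        rw [MarkovModel.expect_add, MarkovModel.expect_const, MarkovModel.expect_mul_left]
        have h1 := hL i N (by omega) (hNi i (by omega))
        have h2 : 1 / ε * H.split.expect a N
            (fun x => (h (M.chainAt x i) - h (M.chainAt x L)) ^ 2) ≤ 1 / ε * ε ^ 2 := by gcongr
        have h3 : 1 / ε * ε ^ 2 = ε := by field_simp
        linarith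
    have hsum : ∑ i ∈ Finset.range k, E (fun x => |h (M.chainAt x i) - h (M.chainAt x L)|) ≤
        2 * B' * L + k * (2 * ε) := by
      refine (Finset.sum_le_sum fun i hi => hterm i (Finset.mem_range.mp hi)).trans ?_
      rw [Finset.sum_add_distrib, Finset.sum_const, Finset.card_range, nsmul_eq_mul,
        ← Finset.sum_filter, Finset.sum_const, nsmul_eq_mul, mul_comm (2 * B')]
      have : ((Finset.range k).filter fun i => i < L).card ≤ L := by
        calc _ ≤ (Finset.range L).card := Finset.card_le_card fun i hi => by
              simpa using (Finset.mem_filter.mp hi).2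
          _ = L := Finset.card_range L
      gcongr
    have hZ : E (fun x => |Z x|) ≤ ε * n + 1 / (ε * n) * (k * (2 * B) ^ 2) := by
      -- At scale `ε * n`, the `O(n)` second moment contributes only `O(1 / ε)`.
      have hεn : 0 < ε * n := by positivity
      refine (MarkovModel.expect_mono fun x => abs_le_add_sq_div hεn).trans ?_
      rw [MarkovModel.expect_add, MarkovModel.expect_const, MarkovModel.expect_mul_left]
      gcongr
      exact M.expect_sq_fluctuation_le H a hB M.margin n k N (hNi k (by omega))
    have hZ' : E (fun x => |Z x|) ≤ ε * n + 8 * q * B ^ 2 / ε := by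
      refine hZ.trans ?_
      gcongr
      calc 1 / (ε * n) * (k * (2 * B) ^ 2) ≤ 1 / (ε * n) * (2 * q * n * (2 * B) ^ 2) := by gcongr
        _ = 8 * q * B ^ 2 / ε := by field_simp; ring
    have hpoint : ∀ x, |ratio x - h (M.chainAt x L)| ≤ C / n + 2 * G / n *
        (∑ i ∈ Finset.range k, |h (M.chainAt x i) - h (M.chainAt x L)| + |Z x| + 2 * B) := by
      intro x
      have h1 := hC n (fun i : Fin n => (x i).2) (fun k => (x k).2) hn fun _ => rfl
      have h2 := hM.abs_mean_shift_sub_le H hhg hB hn L x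
      exact (abs_sub_le _ (mean x) _).trans (add_le_add h1 h2)
    rw [hratio, ← hmean]
    simp only [E]
    rw [← MarkovModel.expect_sub]
    refine (MarkovModel.abs_expect_le _).trans ((MarkovModel.expect_mono hpoint).trans ?_)
    rw [MarkovModel.expect_add, MarkovModel.expect_const, MarkovModel.expect_mul_left,
      MarkovModel.expect_add, MarkovModel.expect_add, MarkovModel.expect_const,
      MarkovModel.expect_sum]
    have hks : (k : ℝ) * (2 * ε) ≤ 2 * q * n * (2 * ε) := by gcongr
    calc _ ≤ C / n + 2 * G / n * ((2 * B' * L + 2 * q * n * (2 * ε)) +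
          (ε * n + 8 * q * B ^ 2 / ε) + 2 * B) := by
          gcongr
          exact hsum.trans (by linarith)
      _ = _ := by field_simp; ring
  rw [Metric.tendsto_atTop]
  intro η hη
  set D := 2 * G * (4 * q + 1) with hD
  have hD0 : 0 ≤ D := by positivity
  -- The `+ 1` avoids dividing by zero when `D = 0`.
  obtain ⟨C', hC'⟩ := main (η / (2 * (D + 1))) (by positivity)
  have hlim := (tendsto_const_div_atTop_nhds_zero_nat C').eventually_lt_const
    (by positivity : (0 : ℝ) < η / 2)
  obtain ⟨n₀, hn₀⟩ := eventually_atTop.mp hlim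
  refine ⟨max n₀ (2 * M.margin), fun n hn => ?_⟩
  rw [Real.dist_eq]
  have h1 := hC' n ((le_max_right _ _).trans hn)
  have h2 := hn₀ n ((le_max_left _ _).trans hn)
  have h3 : D * (η / (2 * (D + 1))) ≤ η / 2 := by
    rw [mul_div_assoc', div_le_div_iff₀ (by positivity) (by positivity)]
    nlinarith
  linarith

end MatchingMachine

theorem mainTheorem5 {A Q S : Type*} [Fintype A] [Fintype Q] [Fintype S] {m : ℕ}
    (w : Fin m → A) (M : MatchingMachine w Q) (pad : EndConvention A) (hM : M.IsValid pad)
    (H : HMM S A) :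
    (∀ n : ℕ, m ≤ n → ∀ t : Fin n → A,
      (M.iterations pad t).Finite ∧ 0 < M.accesses pad t) ∧
    ∃ α : M.ChainState S → ℝ,
      (∀ c, Tendsto (fun k : ℕ => (M.chain H).meanFreq c k) atTop (𝓝 (α c))) ∧
      Tendsto (fun n : ℕ => M.expectedRatio pad H n) atTop
        (𝓝 (∑ c, (M.chainShift c : ℝ) * α c)) := by
  refine ⟨fun n hn t => hM.finite_iterations_and_accesses_pos hn t, ?_⟩
  obtain ⟨α, hα, hsum⟩ := (M.chain H).exists_limitFreq
  obtain ⟨h, g, hh, hhg⟩ :=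
    (M.chain H).exists_harmonic_add_coboundary fun c => (M.chainShift c : ℝ)
  refine ⟨α, hα, ?_⟩
  rw [hsum _ h g hh hhg]
  exact hM.tendsto_expectedRatio H hh hhg
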